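/- Let $\mathbb{F}$ be an algebraically closed field of characteristic $0$ or $p>3$. A Lie algebra $L$ over $\mathbb{F}$ is said to be generated by one and a half elements ($1.5$-generated) if for every non-zero $x\in L$ there exists $y\in L$ such that $x$ and $y$ generate $L$ as a Lie algebra over $\mathbb{F}$. Then: 1. For every $n$ and every non-central element $x$ of $\mathfrak{gl}_n=\mathfrak{gl}_n(\mathbb{F})$, there exists $y\in\mathfrak{gl}_n$ such that $x$ and $y$ generate the Lie algebra $\mathfrak{gl}_n$. 2. For every $n$, the Lie algebra $\mathfrak{pgl}_n$ (the quotient of $\mathfrak{gl}_n$ by its centre) is generated by one and a half elements. 3. Let $\mathfrak{p}$ be a perfect Lie algebra over $\mathbb{F}$ (that is, $[\mathfrak{p},\mathfrak{p}]=\mathfrak{p}$) which is generated by one and a half elements, and let $$0\longrightarrow \mathfrak{c}\longrightarrow\mathfrak{g}\longrightarrow\mathfrak{p}\longrightarrow 0$$ be a central extension of Lie algebras over $\mathbb{F}$ (a short exact sequence in which the image of $\mathfrak{c}$ is contained in the centre of $\mathfrak{g}$) with $\dim_{\mathbb{F}}\mathfrak{c}=1$. Then for every non-central element $x\in\mathfrak{g}$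 there exists $y\in\mathfrak{g}$ such that $x$ and $y$ generate $\mathfrak{g}$. -/

import Mathlib

/-- The elements `x` and `y` generate the Lie algebra `L` over `F`: the smallest Lie subalgebra
containing both is `L` itself. -/
def LieGeneratingPair (F : Type*) {L : Type*} [CommRing F] [LieRing L] [LieAlgebra F L]
    (x y : L) : Prop :=
  LieSubalgebra.lieSpan F L {x, y} = ⊤

/-- `L` is generated by one and a half elements: every nonzero element can be completed to a
generating pair. -/
def IsGeneratedByOneAndAHalf (F L : Type*) [CommRing F] [LieRing L] [LieAlgebra F L] : Prop :=
  ∀ x : L, x ≠ 0 → ∃ y : L, LieGeneratingPair F x y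

/-- `L` is perfect: `[L, L] = L`. -/
def IsPerfectLieAlgebra (F L : Type*) [CommRing F] [LieRing L] [LieAlgebra F L] : Prop :=
  ⁅(⊤ : LieIdeal F L), (⊤ : LieIdeal F L)⁆ = ⊤

attribute [local instance 100] LieRing.ofAssociativeRing

/-- The Lie algebra `gl_n` of all `n × n` matrices, with bracket `[A, B] = A * B - B * A`. -/
abbrev LieGL (n : ℕ) (F : Type*) [CommRing F] : Type _ :=
  Matrix (Fin n) (Fin n) F

/-- The Lie algebra `pgl_n`, the quotient of `gl_n` by its centre. -/
abbrev LiePGL (n : ℕ) (F : Type*) [CommRing F] : Type _ :=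
  LieGL n F ⧸ LieAlgebra.center F (LieGL n F)

/-- `0 → C → E → Q → 0` is a central extension of Lie algebras: it is a short exact sequence of
Lie algebra homomorphisms and the image of `C` is contained in the centre of `E`. -/
structure IsCentralLieExtension {F C E Q : Type*} [CommRing F]
    [LieRing C] [LieAlgebra F C] [LieRing E] [LieAlgebra F E] [LieRing Q] [LieAlgebra F Q]
    (i : C →ₗ⁅F⁆ E) (π : E →ₗ⁅F⁆ Q) : Prop where
  isExtension : LieAlgebra.IsExtension i π
  central : ∀ c : C, i c ∈ LieAlgebra.center F E

/-! For `gl_n`, matrix units are eigenvectors of `ad` of a diagonal matrix. If the differences `d i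
- d j` separate the off-diagonal positions, polynomials in this `ad` extract every off-diagonal
matrix unit from a matrix without zeros off the diagonal. Brackets then give the traceless diagonal
matrices, and a nonzero trace supplies the rest (`lieGeneratingPair_diagonal`). Genericity provides
both ingredients: a suitable `d`, and a conjugate of the noncentral `x` with no off-diagonal zeros.
The case of `pgl_n` follows by projection.

For a central extension, a lift of a generating pair of the quotient spans the extension modulo the
centre, hence generates all brackets. Only the central line can be missed, and moving `y` along that
line repairs this. -/

/-- Finitely many nonzero polynomials over an infinite domain have a common nonroot. -/
theorem MvPolynomial.exists_forall_eval_ne_zero {R σ ι : Type*} [CommRing R] [IsDomain R]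
    [Infinite R] [Fintype ι] (p : ι → MvPolynomial σ R) (hp : ∀ i, p i ≠ 0) :
    ∃ v : σ → R, ∀ i, MvPolynomial.eval v (p i) ≠ 0 := by
  by_contra! h
  refine Finset.prod_ne_zero_iff.mpr (fun i _ => hp i) (MvPolynomial.funext
    (p := ∏ i, p i) (q := 0) fun v => ?_)
  obtain ⟨i, hi⟩ := h v
  rw [map_prod, map_zero]
  exact Finset.prod_eq_zero (Finset.mem_univ i) hi

/-- A surjective homomorphism maps generating pairs to generating pairs. -/
theorem LieGeneratingPair.map {F L M : Type*} [CommRing F] [LieRing L] [LieAlgebra F L]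
    [LieRing M] [LieAlgebra F M] (f : L →ₗ⁅F⁆ M) (hf : Function.Surjective f) {x y : L}
    (h : LieGeneratingPair F x y) : LieGeneratingPair F (f x) (f y) := by
  unfold LieGeneratingPair at *
  rw [← Set.image_pair, ← LieSubalgebra.map_lieSpan, h, eq_top_iff]
  intro z _
  obtain ⟨w, rfl⟩ := hf z
  exact (LieSubalgebra.mem_map _ _ _).mpr ⟨w, LieSubalgebra.mem_top w, rfl⟩

/-- A subspace stable under an endomorphism is stable under all polynomials in it. -/
theorem Submodule.aeval_apply_mem {F V : Type*} [CommRing F] [AddCommGroup V] [Module F V]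
    (S : Submodule F V) (T : Module.End F V) (hT : ∀ v ∈ S, T v ∈ S) (q : Polynomial F)
    {v : V} (hv : v ∈ S) : Polynomial.aeval T q v ∈ S := by
  induction q using Polynomial.induction_on' generalizing v with
  | add p q hp hq =>
    rw [map_add, LinearMap.add_apply]
    exact S.add_mem (hp hv) (hq hv)
  | monomial k a =>
    rw [Polynomial.aeval_monomial, Module.End.mul_apply, Module.algebraMap_end_apply]
    refine S.smul_mem _ ?_
    induction k generalizing v with
    | zero => simpa using hv
    | succ k ih => rw [pow_succ, Module.End.mul_apply]; exact ih (hT v hv)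

/-! ### Generating pairs of matrices -/

section Matrix

variable {n : Type*} [Fintype n] [DecidableEq n] {F : Type*} [Field F]

theorem Matrix.lie_diagonal_apply (d : n → F) (m : Matrix n n F) (i j : n) :
    ⁅Matrix.diagonal d, m⁆ i j = (d i - d j) * m i j := by
  rw [Ring.lie_def, Matrix.sub_apply, Matrix.diagonal_mul, Matrix.mul_diagonal]
  ring

/-- The matrix unit at `(i, j)` is an eigenvector with eigenvalue `d i - d j`, so a polynomial
vanishing at unwanted differences erases the corresponding entries. -/
theorem Matrix.aeval_ad_diagonal_apply (d : n → F) (q : Polynomial F) (m : Matrix n n F)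
    (i j : n) :
    (Polynomial.aeval (LieAlgebra.ad F (Matrix n n F) (Matrix.diagonal d)) q m) i j =
      q.eval (d i - d j) * m i j := by
  induction q using Polynomial.induction_on' with
  | add p q hp hq =>
    rw [map_add, LinearMap.add_apply, Matrix.add_apply, hp, hq, Polynomial.eval_add, add_mul]
  | monomial k a =>
    rw [Polynomial.aeval_monomial, Module.End.mul_apply, Module.algebraMap_end_apply,
      Matrix.smul_apply, Polynomial.eval_monomial, smul_eq_mul, mul_assoc]
    congr 1
    induction k generalizing m with
    | zero => simp
    | succ k ih =>
      rw [pow_succ, Module.End.mul_apply, ih, LieAlgebra.ad_apply, Matrix.lie_diagonal_apply]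
      ring

/-- A matrix without zeros off the diagonal and a diagonal matrix of nonzero trace whose
off-diagonal differences of entries are pairwise distinct and nonzero generate the Lie algebra
of all matrices. -/
theorem lieGeneratingPair_diagonal (d : n → F) (x : Matrix n n F)
    (hx : ∀ i j, i ≠ j → x i j ≠ 0)
    (hd : ∀ i j k l, i ≠ j → (k, l) ≠ (i, j) → d k - d l ≠ d i - d j)
    (ht : ∑ i, d i ≠ 0) :
    LieGeneratingPair F x (Matrix.diagonal d) := by
  classical
  unfold LieGeneratingPair
  set S := LieSubalgebra.lieSpan F (Matrix n n F) {x, Matrix.diagonal d} with hS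
  have hxS : x ∈ S := LieSubalgebra.subset_lieSpan (by simp)
  have hdS : Matrix.diagonal d ∈ S := LieSubalgebra.subset_lieSpan (by simp)
  have hoff : ∀ i j, i ≠ j → ∀ a, Matrix.single i j a ∈ S := by
    intro i j hij a
    -- The differences at all other positions, including `0` from the diagonal; `q` kills exactly
    -- those entries.
    let W := (Finset.univ.erase (i, j)).image fun p : n × n => d p.1 - d p.2
    let q : Polynomial F := ∏ c ∈ W, (Polynomial.X - Polynomial.C c)
    have hq : q.eval (d i - d j) ≠ 0 := by
      rw [Polynomial.eval_prod, Finset.prod_ne_zero_iff]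
      intro c hc
      obtain ⟨⟨k, l⟩, hp, rfl⟩ := Finset.mem_image.mp hc
      simpa [sub_eq_zero] using (hd i j k l hij (Finset.ne_of_mem_erase hp)).symm
    have hmem := S.toSubmodule.aeval_apply_mem
      (LieAlgebra.ad F (Matrix n n F) (Matrix.diagonal d)) (fun v hv => S.lie_mem hdS hv) q hxS
    have heq : Polynomial.aeval (LieAlgebra.ad F (Matrix n n F) (Matrix.diagonal d)) q x =
        Matrix.single i j (q.eval (d i - d j) * x i j) := by
      ext k l
      rw [Matrix.aeval_ad_diagonal_apply]
      by_cases hkl : (k, l) = (i, j)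
      · obtain ⟨rfl, rfl⟩ := Prod.mk.inj hkl
        rw [Matrix.single_apply_same]
      · have h0 : q.eval (d k - d l) = 0 := by
          rw [Polynomial.eval_prod]
          refine Finset.prod_eq_zero (i := d k - d l) (Finset.mem_image.mpr
            ⟨(k, l), Finset.mem_erase.mpr ⟨hkl, Finset.mem_univ _⟩, rfl⟩) ?_
          simp
        rw [h0, zero_mul, Matrix.single_apply_of_ne]
        rintro ⟨rfl, rfl⟩
        exact hkl rfl
    rw [heq] at hmem
    have := S.smul_mem (a / (q.eval (d i - d j) * x i j)) hmem
    rwa [Matrix.smul_single, smul_eq_mul, div_mul_cancel₀ _ (mul_ne_zero hq (hx i j hij))] at this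
  have hdiff : ∀ i j a, Matrix.single i i a - Matrix.single j j a ∈ S := by
    intro i j a
    by_cases hij : i = j
    · subst hij
      rw [sub_self]
      exact S.zero_mem
    · have := S.lie_mem (hoff i j hij a) (hoff j i (Ne.symm hij) 1)
      rwa [Ring.lie_def, Matrix.single_mul_single_same, Matrix.single_mul_single_same, mul_one,
        one_mul] at this
  have hdiag : ∀ i a, Matrix.single i i a ∈ S := by
    intro i a
    have h1 : Matrix.single i i (∑ j, d j) ∈ S := by
      -- Modulo traceless diagonal matrices, `diagonal d` is its trace times the matrix unit at `(i,
      -- i)`.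
      have h2 : Matrix.single i i (∑ j, d j) =
          ∑ j, (Matrix.single i i (d j) - Matrix.single j j (d j)) + Matrix.diagonal d := by
        rw [Finset.sum_sub_distrib, Matrix.sum_single_eq_diagonal, sub_add_cancel]
        exact map_sum (Matrix.singleAddMonoidHom i i) d Finset.univ
      rw [h2]
      exact S.add_mem (sum_mem fun j _ => hdiff i j (d j)) hdS
    have := S.smul_mem (a / ∑ j, d j) h1
    rwa [Matrix.smul_single, smul_eq_mul, div_mul_cancel₀ _ ht] at this
  rw [eq_top_iff]
  intro m _
  rw [Matrix.matrix_eq_sum_single m]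
  refine sum_mem fun i _ => sum_mem fun j _ => ?_
  by_cases hij : i = j
  · subst hij
    exact hdiag i _
  · exact hoff i j hij _

/-- Over an infinite field of characteristic other than two there are diagonal matrices as in
`lieGeneratingPair_diagonal`. -/
theorem exists_generic_diagonal [Infinite F] (h2 : (2 : F) ≠ 0) [Nonempty n] :
    ∃ d : n → F, (∀ i j k l, i ≠ j → (k, l) ≠ (i, j) → d k - d l ≠ d i - d j) ∧
      ∑ i, d i ≠ 0 := by
  classical
  let I := {p : (n × n) × (n × n) // p.1.1 ≠ p.1.2 ∧ p.2 ≠ p.1}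
  -- `none` encodes the trace condition, `some` a coincidence of two differences.
  let p : Option I → MvPolynomial n F := fun o => o.elim (∑ i, MvPolynomial.X i) fun p =>
    (MvPolynomial.X p.1.1.1 - MvPolynomial.X p.1.1.2) -
      (MvPolynomial.X p.1.2.1 - MvPolynomial.X p.1.2.2)
  have hp : ∀ o, p o ≠ 0 := by
    rintro (_ | ⟨⟨⟨i, j⟩, ⟨k, l⟩⟩, hij, hkl⟩) h0
    · have := congrArg (MvPolynomial.eval (Pi.single (Classical.arbitrary n) (1 : F))) h0
      simp [p] at this
    · dsimp only at hij hkl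
      have key : ∀ v : n → F, (v i - v j) - (v k - v l) = 0 := fun v => by
        simpa [p] using congrArg (MvPolynomial.eval v) h0
      by_cases hk : k = i
      · subst hk
        have hl : l ≠ j := fun h => hkl (by rw [h])
        have := key (Pi.single j 1)
        simp [hij, hl] at this
      · have := key (Pi.single i 1)
        by_cases hl : l = i
        · subst hl
          simp [hk, hij.symm, one_add_one_eq_two, h2] at this
        · simp [hk, hij.symm, hl] at this
  obtain ⟨d, hd⟩ := MvPolynomial.exists_forall_eval_ne_zero p hp
  refine ⟨d, fun i j k l hij hkl heq => hd (some ⟨((i, j), (k, l)), hij, hkl⟩) ?_, ?_⟩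
  · simp [p, heq]
  · simpa [p] using hd none

theorem Equiv.Perm.exists_apply_eq_and_apply_eq {α : Type*} [DecidableEq α] {i j k l : α}
    (hij : i ≠ j) (hkl : k ≠ l) : ∃ σ : Equiv.Perm α, σ i = k ∧ σ j = l := by
  refine ⟨Equiv.swap (Equiv.swap i k j) l * Equiv.swap i k, ?_, ?_⟩
  · rw [Equiv.Perm.mul_apply, Equiv.swap_apply_left, Equiv.swap_apply_of_ne_of_ne _ hkl]
    intro h
    apply hij
    apply (Equiv.swap i k).injective
    rw [← h, Equiv.swap_apply_left]
  · rw [Equiv.Perm.mul_apply, Equiv.swap_apply_left]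

/-- A nonscalar matrix has a conjugate with nonzero entry at any given off-diagonal position. -/
theorem Matrix.exists_conj_apply_ne_zero (x : Matrix n n F)
    (hx : x ∉ Set.range (Matrix.scalar n)) {i j : n} (hij : i ≠ j) :
    ∃ g : GL n F, ((g : Matrix n n F) * x * ((g⁻¹ : GL n F) : Matrix n n F)) i j ≠ 0 := by
  by_contra! h
  have hall : ∀ (g : GL n F) (k l : n), k ≠ l →
      ((g : Matrix n n F) * x * ((g⁻¹ : GL n F) : Matrix n n F)) k l = 0 := by
    intro g k l hkl
    obtain ⟨σ, rfl, rfl⟩ := Equiv.Perm.exists_apply_eq_and_apply_eq hij hkl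
    -- Conjugation by a permutation matrix moves position `(i, j)` to `(k, l)`, so one position
    -- decides all.
    let s : GL n F := ⟨σ.permMatrix F, (σ⁻¹).permMatrix F,
      by rw [← Matrix.permMatrix_mul]; simp, by rw [← Matrix.permMatrix_mul]; simp⟩
    have hs : (s : Matrix n n F) = σ.toPEquiv.toMatrix := rfl
    have hs' : ((s⁻¹ : GL n F) : Matrix n n F) = σ⁻¹.toPEquiv.toMatrix := rfl
    have := h (s * g)
    rw [_root_.mul_inv_rev, Units.val_mul, Units.val_mul, hs, hs', ← mul_assoc,
      PEquiv.mul_toMatrix_toPEquiv, mul_assoc, mul_assoc, PEquiv.toMatrix_toPEquiv_mul,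
      ← mul_assoc] at this
    exact this
  refine hx (Matrix.mem_range_scalar_of_commute_single fun k l hkl => ?_)
  have hoff : ∀ k l, k ≠ l → x k l = 0 := fun k l hkl => by simpa using hall 1 k l hkl
  have hsq : Matrix.single k l (1 : F) * Matrix.single k l 1 = 0 :=
    Matrix.single_mul_single_of_ne _ _ _ _ hkl.symm _
  -- For diagonal `x`, conjugation by this transvection puts `x l l - x k k` at `(k, l)`, so the
  -- diagonal entries agree.
  let t : GL n F := ⟨1 + Matrix.single k l 1, 1 - Matrix.single k l 1,
    by rw [add_mul, one_mul, mul_sub, hsq, mul_one, sub_zero, sub_add_cancel],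
    by rw [sub_mul, one_mul, mul_add, hsq, mul_one, add_zero, add_sub_cancel_right]⟩
  have ht : ((1 + Matrix.single k l (1 : F)) * x * (1 - Matrix.single k l (1 : F)) :
      Matrix n n F) k l = 0 := hall t k l hkl
  have hdiag : x = Matrix.diagonal fun i => x i i := by
    ext a b
    by_cases hab : a = b
    · subst hab; simp
    · rw [hoff a b hab, Matrix.diagonal_apply_ne _ hab]
  have hkk : x l l = x k k := by
    simpa [add_mul, mul_sub, hoff k l hkl, hoff l k hkl.symm, sub_eq_zero] using ht
  change _ = _
  ext a b
  rw [hdiag, Matrix.diagonal_mul, Matrix.mul_diagonal]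
  by_cases hab : k = a ∧ l = b
  · obtain ⟨rfl, rfl⟩ := hab
    rw [hkk, mul_comm]
  · rw [Matrix.single_apply_of_ne _ _ _ _ _ hab, zero_mul, mul_zero]

/-- A nonscalar matrix over an infinite field has a conjugate without zeros off the diagonal. -/
theorem Matrix.exists_conj_forall_apply_ne_zero [Infinite F] (x : Matrix n n F)
    (hx : x ∉ Set.range (Matrix.scalar n)) :
    ∃ g : GL n F, ∀ i j, i ≠ j →
      ((g : Matrix n n F) * x * ((g⁻¹ : GL n F) : Matrix n n F)) i j ≠ 0 := by
  classical
  let G := Matrix.mvPolynomialX n n F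
  let I := {p : n × n // p.1 ≠ p.2}
  -- The adjugate replaces the inverse to keep the entries polynomial; on invertible matrices this
  -- only rescales by the determinant.
  let P : Matrix n n (MvPolynomial (n × n) F) :=
    G * (MvPolynomial.C : F →+* MvPolynomial (n × n) F).mapMatrix x * G.adjugate
  have hev : ∀ A : Matrix n n F, ∀ i j,
      MvPolynomial.eval (fun p : n × n => A p.1 p.2) (P i j) = (A * x * A.adjugate) i j := by
    intro A i j
    have hG : (MvPolynomial.eval fun p : n × n => A p.1 p.2).mapMatrix G = A :=
      Matrix.mvPolynomialX_mapMatrix_eval A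
    have hC : (MvPolynomial.eval fun p : n × n => A p.1 p.2).mapMatrix
        ((MvPolynomial.C : F →+* MvPolynomial (n × n) F).mapMatrix x) = x := by
      ext k l
      simp
    have : (MvPolynomial.eval fun p : n × n => A p.1 p.2).mapMatrix P = A * x * A.adjugate := by
      rw [map_mul, map_mul, RingHom.map_adjugate, hG, hC]
    rw [← this]
    rfl
  have hadj : ∀ g : GL n F, ((g : Matrix n n F)).adjugate =
      (g : Matrix n n F).det • ((g⁻¹ : GL n F) : Matrix n n F) := by
    intro g
    have h1 : (g : Matrix n n F) * ((g⁻¹ : GL n F) : Matrix n n F) = 1 := g.mul_inv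
    calc ((g : Matrix n n F)).adjugate
        = (g : Matrix n n F).adjugate * ((g : Matrix n n F) *
          ((g⁻¹ : GL n F) : Matrix n n F)) := by rw [h1, mul_one]
      _ = _ := by rw [← mul_assoc, Matrix.adjugate_mul, smul_mul_assoc, one_mul]
  have hdet : ∀ g : GL n F, (g : Matrix n n F).det ≠ 0 := fun g =>
    ((Matrix.isUnit_iff_isUnit_det _).mp g.isUnit).ne_zero
  let p : Option I → MvPolynomial (n × n) F := fun o => o.elim G.det fun q => P q.1.1 q.1.2
  have hp : ∀ o, p o ≠ 0 := by
    rintro (_ | ⟨⟨i, j⟩, hij⟩) h0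
    · exact Matrix.det_mvPolynomialX_ne_zero n F h0
    · obtain ⟨g, hg⟩ := Matrix.exists_conj_apply_ne_zero x hx hij
      have := congrArg (MvPolynomial.eval (fun p : n × n => (g : Matrix n n F) p.1 p.2)) h0
      simp only [p, Option.elim, hev, map_zero, hadj, mul_smul_comm, Matrix.smul_apply,
        smul_eq_mul, mul_eq_zero] at this
      exact this.elim (hdet g) hg
  obtain ⟨v, hv⟩ := MvPolynomial.exists_forall_eval_ne_zero p hp
  let A : Matrix n n F := Matrix.of fun i j => v (i, j)
  have hvA : v = fun p : n × n => A p.1 p.2 := rfl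
  have hA : A.det ≠ 0 := by
    have h0 := hv none
    have hG : (MvPolynomial.eval fun p : n × n => A p.1 p.2).mapMatrix G = A :=
      Matrix.mvPolynomialX_mapMatrix_eval A
    rwa [show p none = G.det from rfl, RingHom.map_det, hvA, hG] at h0
  refine ⟨Matrix.GeneralLinearGroup.mkOfDetNeZero A hA, fun i j hij h0 => ?_⟩
  have h1 := hv (some ⟨(i, j), hij⟩)
  rw [hvA, show p (some ⟨(i, j), hij⟩) = P i j from rfl, hev] at h1
  have h3 := hadj (Matrix.GeneralLinearGroup.mkOfDetNeZero A hA)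
  have h4 : ((Matrix.GeneralLinearGroup.mkOfDetNeZero A hA : GL n F) : Matrix n n F) = A := rfl
  rw [h4] at h3 h0
  rw [h3, mul_smul_comm, Matrix.smul_apply, h0, smul_zero] at h1
  exact h1 rfl

/-- Over an infinite field of characteristic other than two, every noncentral matrix belongs to
a generating pair of the Lie algebra of all matrices. -/
theorem Matrix.exists_lieGeneratingPair [Infinite F] (h2 : (2 : F) ≠ 0) (x : Matrix n n F)
    (hx : x ∉ LieAlgebra.center F (Matrix n n F)) :
    ∃ y : Matrix n n F, LieGeneratingPair F x y := by
  have hx' : x ∉ Set.range (Matrix.scalar n) := by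
    rintro ⟨c, rfl⟩
    refine hx ((LieModule.mem_maxTrivSubmodule _ _ _ _).mpr fun m => ?_)
    rw [Ring.lie_def, sub_eq_zero]
    exact (Matrix.scalar_commute c (fun r => Commute.all _ _) m).symm
  have : Nonempty n := by
    by_contra h
    rw [not_nonempty_iff] at h
    exact hx' ⟨0, Subsingleton.elim _ _⟩
  obtain ⟨g, hg⟩ := Matrix.exists_conj_forall_apply_ne_zero x hx'
  obtain ⟨d, hd, ht⟩ := exists_generic_diagonal (n := n) h2
  have hgen := lieGeneratingPair_diagonal d _ hg hd ht
  let f : Matrix n n F →ₗ⁅F⁆ Matrix n n F :=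
    { toLinearMap := LinearMap.mulLeft F ((g⁻¹ : GL n F) : Matrix n n F) ∘ₗ
        LinearMap.mulRight F (g : Matrix n n F)
      map_lie' := by
        intro a b
        simp [Ring.lie_def, mul_sub, sub_mul, mul_assoc] }
  have hf : ∀ m, f m = ((g⁻¹ : GL n F) : Matrix n n F) * (m * (g : Matrix n n F)) :=
    fun m => rfl
  have hsurj : Function.Surjective f := fun m =>
    ⟨(g : Matrix n n F) * m * ((g⁻¹ : GL n F) : Matrix n n F), by
      rw [hf]; simp only [mul_assoc, Units.inv_mul, Units.inv_mul_cancel_left, mul_one]⟩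
  refine ⟨f (Matrix.diagonal d), ?_⟩
  have := hgen.map f hsurj
  rwa [hf, show ((g⁻¹ : GL n F) : Matrix n n F) * ((g : Matrix n n F) * x *
    ((g⁻¹ : GL n F) : Matrix n n F) * (g : Matrix n n F)) = x by
      simp only [mul_assoc, Units.inv_mul, Units.inv_mul_cancel_left, mul_one]] at this

end Matrix

/-! ### One-dimensional central extensions -/

section CentralExtension

variable {F P C E : Type*} [Field F] [LieRing P] [LieAlgebra F P] [LieRing C] [LieAlgebra F C]
  [LieRing E] [LieAlgebra F E]

/-- If `E = S + Z` with `Z` central, the Lie subalgebra `S` contains all brackets. -/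
theorem LieSubalgebra.lie_mem_of_codisjoint_center (S : LieSubalgebra F E)
    (hS : ∀ e : E, ∃ s ∈ S, e - s ∈ LieAlgebra.center F E) (a b : E) : ⁅a, b⁆ ∈ S := by
  obtain ⟨s, hs, hsc⟩ := hS a
  obtain ⟨t, ht, htc⟩ := hS b
  have h1 : ⁅b, a - s⁆ = 0 := (LieModule.mem_maxTrivSubmodule _ _ _ _).mp hsc b
  have h2 : ⁅s, b - t⁆ = 0 := (LieModule.mem_maxTrivSubmodule _ _ _ _).mp htc s
  rw [lie_sub, sub_eq_zero] at h1 h2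
  rw [← lie_skew, h1, lie_skew, h2]
  exact S.lie_mem hs ht

/-- In a one-dimensional central extension of a perfect Lie algebra generated by one and a half
elements, every noncentral element belongs to a generating pair. -/
theorem IsCentralLieExtension.exists_lieGeneratingPair {i : C →ₗ⁅F⁆ E} {π : E →ₗ⁅F⁆ P}
    (hext : IsCentralLieExtension i π) (hperf : IsPerfectLieAlgebra F P)
    (hgen : IsGeneratedByOneAndAHalf F P) (hC : Module.finrank F C = 1) (x : E)
    (hx : x ∉ LieAlgebra.center F E) : ∃ y : E, LieGeneratingPair F x y := by
  have hπ : Function.Surjective π := (LieHom.range_eq_top π).mp hext.isExtension.range_eq_top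
  have hker : ∀ e : E, π e = 0 → ∃ c, i c = e := by
    intro e he
    have : e ∈ i.range := by
      rw [hext.isExtension.exact]
      exact (LieHom.mem_ker).mpr he
    exact (LieHom.mem_range _ _).mp this
  have hπi : ∀ c, π (i c) = 0 := by
    intro c
    have : i c ∈ i.range := (LieHom.mem_range _ _).mpr ⟨c, rfl⟩
    rw [hext.isExtension.exact] at this
    exact (LieHom.mem_ker).mp this
  have hinj : Function.Injective i := (LieHom.ker_eq_bot i).mp hext.isExtension.ker_eq_bot
  obtain ⟨c₀, hc₀, hspan⟩ := finrank_eq_one_iff'.mp hC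
  -- The span of all brackets of `E`; it maps onto `P` because `P` is perfect.
  let D : Submodule F E := Submodule.span F {z | ∃ a b : E, ⁅a, b⁆ = z}
  have hDsurj : ∀ p : P, ∃ e ∈ D, π e = p := by
    intro p
    have hp : p ∈ (⁅(⊤ : LieIdeal F P), (⊤ : LieIdeal F P)⁆ : LieIdeal F P).toSubmodule := by
      rw [hperf]; trivial
    rw [LieSubmodule.lieIdeal_oper_eq_linear_span'] at hp
    induction hp using Submodule.span_induction with
    | mem z hz =>
      obtain ⟨a, -, b, -, rfl⟩ := hz
      obtain ⟨a, rfl⟩ := hπ a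
      obtain ⟨b, rfl⟩ := hπ b
      exact ⟨⁅a, b⁆, Submodule.subset_span ⟨a, b, rfl⟩, LieHom.map_lie π a b⟩
    | zero => exact ⟨0, D.zero_mem, map_zero π⟩
    | add p q _ _ hp hq =>
      obtain ⟨d, hd, rfl⟩ := hp
      obtain ⟨e, he, rfl⟩ := hq
      exact ⟨d + e, D.add_mem hd he, map_add π d e⟩
    | smul a p _ hp =>
      obtain ⟨d, hd, rfl⟩ := hp
      exact ⟨a • d, D.smul_mem a hd, map_smul π a d⟩
  have hx0 : π x ≠ 0 := fun h => by
    obtain ⟨c, rfl⟩ := hker x h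
    exact hx (hext.central c)
  obtain ⟨q, hq⟩ := hgen (π x) hx0
  have hlift : ∀ y : E, π y = q → (i c₀ ∈ D ∨ y ∉ D) → LieGeneratingPair F x y := by
    intro y hy hyD
    set S := LieSubalgebra.lieSpan F E {x, y} with hSdef
    have hyS : y ∈ S := LieSubalgebra.subset_lieSpan (by simp)
    have hSsurj : ∀ e : E, ∃ s ∈ S, π s = π e := by
      intro e
      have h1 : S.map π = ⊤ := by
        rw [hSdef, LieSubalgebra.map_lieSpan, Set.image_pair, hy]
        exact hq
      exact (LieSubalgebra.mem_map _ _ _).mp (h1 ▸ LieSubalgebra.mem_top (π e))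
    have hDS : D ≤ S.toSubmodule := by
      refine Submodule.span_le.mpr ?_
      rintro _ ⟨a, b, rfl⟩
      refine S.lie_mem_of_codisjoint_center (fun e => ?_) a b
      obtain ⟨s, hs, hse⟩ := hSsurj e
      obtain ⟨c, hc⟩ := hker (e - s) (by rw [map_sub, hse, sub_self])
      exact ⟨s, hs, hc ▸ hext.central c⟩
    have hc₀S : i c₀ ∈ S := by
      rcases hyD with h | h
      · exact hDS h
      -- If `y ∉ D`, subtracting an element of `D` with the same image leaves a nonzero multiple of
      -- `i c₀`.
      · obtain ⟨e, heD, he⟩ := hDsurj (π y)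
        obtain ⟨c, hc⟩ := hker (y - e) (by rw [map_sub, he, sub_self])
        obtain ⟨a, rfl⟩ := hspan c
        have ha : a ≠ 0 := by
          rintro rfl
          rw [zero_smul, map_zero] at hc
          exact h (sub_eq_zero.mp hc.symm ▸ heD)
        have hmem : i (a • c₀) ∈ S := hc ▸ S.sub_mem hyS (hDS heD)
        rw [map_smul] at hmem
        simpa [smul_smul, ha] using S.smul_mem a⁻¹ hmem
    refine eq_top_iff.mpr fun e _ => ?_
    obtain ⟨s, hs, hse⟩ := hSsurj e
    obtain ⟨c, hc⟩ := hker (e - s) (by rw [map_sub, hse, sub_self])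
    obtain ⟨a, rfl⟩ := hspan c
    rw [map_smul] at hc
    rw [← sub_add_cancel e s, ← hc]
    exact S.add_mem (S.smul_mem a hc₀S) hs
  obtain ⟨y, hy⟩ := hπ q
  by_cases h : i c₀ ∈ D ∨ y ∉ D
  · exact ⟨y, hlift y hy h⟩
  · push Not at h
    -- When `y ∈ D` and `i c₀ ∉ D`, the shifted lift lies outside `D`.
    refine ⟨y + i c₀, hlift _ (by rw [map_add, hπi, hy, add_zero]) (Or.inr fun h' => h.1 ?_)⟩
    simpa using D.sub_mem h' h.2

end CentralExtension

theorem mainTheorem9 (F : Type*) [Field F] [IsAlgClosed F]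
    (hF : ringChar F = 0 ∨ 3 < ringChar F) :
    (∀ (n : ℕ) (x : LieGL n F), x ∉ LieAlgebra.center F (LieGL n F) →
      ∃ y : LieGL n F, LieGeneratingPair F x y) ∧
    (∀ n : ℕ, IsGeneratedByOneAndAHalf F (LiePGL n F)) ∧
    (∀ (P : Type*) [LieRing P] [LieAlgebra F P],
      IsPerfectLieAlgebra F P → IsGeneratedByOneAndAHalf F P →
      ∀ (C E : Type*) [LieRing C] [LieAlgebra F C] [LieRing E] [LieAlgebra F E]
        (i : C →ₗ⁅F⁆ E) (π : E →ₗ⁅F⁆ P),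
        IsCentralLieExtension i π → Module.finrank F C = 1 →
        ∀ x : E, x ∉ LieAlgebra.center F E → ∃ y : E, LieGeneratingPair F x y) := by
  have h2 : (2 : F) ≠ 0 := by
    refine Ring.two_ne_zero ?_
    omega
  have : Infinite F := IsAlgClosed.instInfinite
  refine ⟨fun n x hx => Matrix.exists_lieGeneratingPair h2 x hx, fun n x hx => ?_,
    fun P _ _ hperf hgen C E _ _ _ _ i π hext hC x hx =>
      hext.exists_lieGeneratingPair hperf hgen hC x hx⟩
  let f := LieSubmodule.Quotient.mk' (LieAlgebra.center F (LieGL n F))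
  obtain ⟨x, rfl⟩ := LieSubmodule.Quotient.surjective_mk' (LieAlgebra.center F (LieGL n F)) x
  obtain ⟨y, hy⟩ := Matrix.exists_lieGeneratingPair h2 x fun h =>
    hx ((LieSubmodule.Quotient.mk_eq_zero _).mpr h)
  let φ : LieGL n F →ₗ⁅F⁆ LiePGL n F := { toLinearMap := f.toLinearMap, map_lie' := rfl }
  exact ⟨φ y, hy.map φ (LieSubmodule.Quotient.surjective_mk' _)⟩
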